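/- **Model.** Let $G=(V,E)$ be a digraph (no loops, no multiple edges) on a finite nonempty set of parties. A *$T$-round transmission function* $x_v$ for a party $v$ with indegree $d^-$ and outdegree $d^+$ takes as input $d^-$ bit sequences of a common length $<T$ and returns $d^+$ bits. In the *universal protocol* $\pi^*[G,T]$ each party $v$ is given a transmission function $x_v$; in each of $T$ synchronous rounds she sends to each out-neighbour the bit that $x_v$ prescribes for the bits she has received so far; her output is the list of all the bits she received. A *black-box simulation* of $\pi^*[G,T]$ is a synchronous protocol with some number $\tilde T$ of rounds, running on $G$ or a subgraph of it on the same vertex set, in which one bit is sent along each edge in each round, the parties have independent private randomness, and each party $v$ accesses $x_v$ only by adaptively specifying inputs to $x_v$ and being given the corresponding outputs; at the end every party outputs a guess for her output in the noiseless execution of $\pi^*[G,T]$. Its *query complexity* is the largest total number of queries that the parties make in any execution (with any inputs, randomness and channel noise). A *polynomial-query black-box compiler* $C$ assigns to each $\pi^*[G,T]$ a black-box simulation $C(\pi^*[G,T])$ such that for every $G$ there is a polynomial $\mathcal Q$ for which the query complexity of $C(\pi^*[G,T])$ is at most $\mathcal Q(T)$ for all $T$. An *adversary* knows all inputs and all communication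 up to and including the bits sent in the current round, but not the parties' private randomness, and chooses which bits arrive. She stays within the *per-edge error rate* $\rho$ if in every execution, on each edge of the network on which the simulation runs, at most $\rho\tilde T$ of the $\tilde T$ transmitted bits are flipped. The *failure probability* in the presence of the per-edge error rate $\rho$ is the supremum, over all inputs and all adversaries within this rate, of the probability that some party's output differs from her output in the noiseless execution of $\pi^*[G,T]$. The *chain-length* $R$ of $G$ is the maximum, over all directed walks in $G$, of the number of distinct vertices visited. **Theorem.** Let $C$ be a polynomial-query black-box compiler, and let $G$ be a digraph (with at least one vertex) that has no isolated vertices and has chain-length $R$. Then the failure probability of $C(\pi^*[G,T])$ in the presence of the per-edge error rate $\frac4R$ tends to $1$ as $T\to\infty$. Consequently no such compiler tolerates a per-edge error rate of $4/R$ or more: if for some real $\rho$ and some $c<1$ the failure probability of $C(\pi^*[G,T])$ in the presence of the per-edge error rate $\rho$ is at most $c$ for infinitely many $T$, then $\rho<\frac4R$. -/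

import Mathlib

open Filter Topology MeasureTheory
open scoped ENNReal

namespace NoisyNetwork

/-! ### Digraphs -/

/-- A digraph without loops. (A `Digraph` never has multiple edges.) -/
def IsSimple {V : Type} (G : Digraph V) : Prop := ∀ v, ¬ G.Adj v v

/-- Every vertex is an endpoint of at least one edge. -/
def NoIsolatedVertices {V : Type} (G : Digraph V) : Prop :=
  ∀ v, ∃ u, G.Adj u v ∨ G.Adj v u

/-- In-neighbours of `v`. Equivalently, edges entering `v`. -/
abbrev InNbr {V : Type} (G : Digraph V) (v : V) : Type := {u : V // G.Adj u v}

/-- Out-neighbours of `v`. Equivalently, edges leaving `v`. -/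
abbrev OutNbr {V : Type} (G : Digraph V) (v : V) : Type := {w : V // G.Adj v w}

/-- Directed edges of `G`. -/
abbrev Edge {V : Type} (G : Digraph V) : Type := {e : V × V // G.Adj e.1 e.2}

/-- The chain-length: the maximum, over all directed walks (given by their nonempty lists of
consecutive vertices), of the number of distinct vertices visited. On a finite vertex set the set
below is bounded by the number of vertices, so that `sSup` is a maximum. -/
noncomputable def chainLength {V : Type} [DecidableEq V] (G : Digraph V) : ℕ :=
  sSup {k : ℕ | ∃ W : List V, W ≠ [] ∧ W.IsChain G.Adj ∧ W.toFinset.card = k}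

/-! ### The universal protocol -/

/-- What a `T`-round transmission function of `v` takes as input: for each in-neighbour a
sequence of received bits, all of the same length `s < T`. -/
abbrev Query {V : Type} (G : Digraph V) (T : ℕ) (v : V) : Type :=
  (s : Fin T) × (Fin s → InNbr G v → Bool)

/-- A `T`-round transmission function of party `v`; its values prescribe one bit to transmit to
each out-neighbour. -/
abbrev TransmissionFn {V : Type} (G : Digraph V) (T : ℕ) (v : V) : Type :=
  Query G T v → (OutNbr G v → Bool)

/-- A joint input: one transmission function for each party. -/
abbrev Input {V : Type} (G : Digraph V) (T : ℕ) : Type := (v : V) → TransmissionFn G T v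

/-- The bits received by each party in the first `t` rounds of the (noiseless) universal
protocol on input `x`: in each round every party sends what her transmission function prescribes
for the bits that she has received so far. -/
def received {V : Type} {G : Digraph V} {T : ℕ} (x : Input G T) :
    (t : ℕ) → t ≤ T → (v : V) → Fin t → InNbr G v → Bool
  | 0, _, _ => fun i => i.elim0
  | t + 1, h, v =>
      Fin.snoc (α := fun _ => InNbr G v → Bool) (received x t (Nat.le_of_succ_le h) v)
        (fun u => x u.1 ⟨⟨t, h⟩, received x t (Nat.le_of_succ_le h) u.1⟩ ⟨v, u.2⟩)

/-- The output of party `v` in the universal protocol: all the bits that she received. -/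
def universalOutput {V : Type} {G : Digraph V} {T : ℕ} (x : Input G T) (v : V) :
    Fin T → InNbr G v → Bool :=
  received x T le_rfl v

/-! ### Black-box simulations -/

/-- A computation that returns an element of `R` and may, adaptively, make queries `q : Q` that
are answered by elements of `A`. -/
inductive QueryComp (Q A R : Type) : Type
  | pure (r : R) : QueryComp Q A R
  | query (q : Q) (k : A → QueryComp Q A R) : QueryComp Q A R

/-- Run a computation, with queries answered by `f`. The second component of the result is the
number of queries made. -/
def QueryComp.run {Q A R : Type} (f : Q → A) : QueryComp Q A R → R × ℕ
  | .pure r => (r, 0)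
  | .query q k => (((k (f q)).run f).1, ((k (f q)).run f).2 + 1)

/-- A (randomized) synchronous protocol on a subnetwork `net` of `G`, in which each party `v` has
a private source of randomness and has access to her input, a transmission function, only by
queries to it. In each of the `rounds` rounds, every party, depending on her local state,
makes queries, updates her state and sends one bit along each outgoing edge of `net`; then she
updates her state with the bits that arrive along the incoming edges of `net`. After the last
round she may make further queries and gives an output, her guess of the bits that she would have
received in the universal protocol on `G`. -/
structure BlackBoxSimulation {V : Type} (G : Digraph V) (T : ℕ) where
  /-- the network on which the simulation runs -/
  net : Digraph V
  net_le : ∀ u v, net.Adj u v → G.Adj u v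
  /-- the round complexity -/
  rounds : ℕ
  /-- the private randomness of each party -/
  Coins : V → Type
  coinsMeasurableSpace : ∀ v, MeasurableSpace (Coins v)
  coinLaw : ∀ v, Measure (Coins v)
  isProbabilityMeasure_coinLaw : ∀ v, IsProbabilityMeasure (coinLaw v)
  /-- the local states of each party -/
  State : V → Type
  init : ∀ v, Coins v → State v
  send : ∀ v, State v →
    QueryComp (Query G T v) (OutNbr G v → Bool) (State v × (OutNbr net v → Bool))
  receive : ∀ v, State v → (InNbr net v → Bool) → State v
  output : ∀ v, State v →
    QueryComp (Query G T v) (OutNbr G v → Bool) (Fin T → InNbr G v → Bool)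

attribute [instance] BlackBoxSimulation.coinsMeasurableSpace
  BlackBoxSimulation.isProbabilityMeasure_coinLaw

namespace BlackBoxSimulation

variable {V : Type} [Fintype V] {G : Digraph V} {T : ℕ}

/-- An adversary. She knows all the inputs and all the bits sent so far (the second
argument, a list with one entry per round, the current round first; what arrived in earlier
rounds is determined by these data), but not the private randomness of the parties. She decides
which bits arrive in the current round. -/
abbrev Adversary (S : BlackBoxSimulation G T) : Type :=
  Input G T → List (Edge S.net → Bool) → (Edge S.net → Bool)

/-- The situation between two rounds of an execution. -/
structure Config (S : BlackBoxSimulation G T) where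
  /-- the local states of the parties -/
  state : ∀ v, S.State v
  /-- the bits sent so far, the latest round first -/
  sent : List (Edge S.net → Bool)
  /-- for each edge, the number of bits sent along it that the adversary has flipped -/
  flips : Edge S.net → ℕ
  /-- the total number of queries made by all parties -/
  queries : ℕ

/-- The situation before the first round, given the private randomness `ω`. -/
def start (S : BlackBoxSimulation G T) (ω : ∀ v, S.Coins v) : Config S where
  state := fun v => S.init v (ω v)
  sent := []
  flips := fun _ => 0
  queries := 0

/-- One round, on input `x`, in the presence of the adversary `A`. -/
def step (S : BlackBoxSimulation G T) (A : S.Adversary) (x : Input G T) (c : Config S) :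
    Config S :=
  let r := fun v => (S.send v (c.state v)).run (x v)
  let out : Edge S.net → Bool := fun e => (r e.1.1).1.2 ⟨e.1.2, e.2⟩
  let arrive : Edge S.net → Bool := A x (out :: c.sent)
  { state := fun v => S.receive v (r v).1.1 (fun u => arrive ⟨(u.1, v), u.2⟩)
    sent := out :: c.sent
    flips := fun e => c.flips e + if arrive e = out e then 0 else 1
    queries := c.queries + ∑ v, (r v).2 }

/-- The situation after all the rounds. -/
def final (S : BlackBoxSimulation G T) (A : S.Adversary) (x : Input G T)
    (ω : ∀ v, S.Coins v) : Config S :=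
  (S.step A x)^[S.rounds] (S.start ω)

/-- The output of party `v`, together with the number of queries made after the last round. -/
def finalOutput (S : BlackBoxSimulation G T) (A : S.Adversary) (x : Input G T)
    (ω : ∀ v, S.Coins v) (v : V) : (Fin T → InNbr G v → Bool) × ℕ :=
  (S.output v ((S.final A x ω).state v)).run (x v)

/-- The total number of queries made by all the parties in an execution. -/
def totalQueries (S : BlackBoxSimulation G T) (A : S.Adversary) (x : Input G T)
    (ω : ∀ v, S.Coins v) : ℕ :=
  (S.final A x ω).queries + ∑ v, (S.finalOutput A x ω v).2

/-- The largest number of queries that the parties ever collectively make. -/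
noncomputable def queryComplexity (S : BlackBoxSimulation G T) : ℕ∞ :=
  ⨆ (A : S.Adversary) (x : Input G T) (ω : ∀ v, S.Coins v), (S.totalQueries A x ω : ℕ∞)

/-- An execution fails if some party does not output exactly the bits that she would have received
in the universal protocol on a noiseless network. -/
def Fails (S : BlackBoxSimulation G T) (A : S.Adversary) (x : Input G T)
    (ω : ∀ v, S.Coins v) : Prop :=
  ∃ v, (S.finalOutput A x ω v).1 ≠ universalOutput x v

/-- The adversary stays within the per-edge error rate `ρ`: in every execution, on each edge, at
most the fraction `ρ` of the bits transmitted on that edge (one per round) are flipped. -/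
def WithinPerEdgeRate (S : BlackBoxSimulation G T) (A : S.Adversary) (ρ : ℝ) : Prop :=
  ∀ (x : Input G T) (ω : ∀ v, S.Coins v) (e : Edge S.net),
    ((S.final A x ω).flips e : ℝ) ≤ ρ * S.rounds

/-- The failure probability in the presence of the per-edge error rate `ρ`: the supremum, over all
inputs and all adversaries that stay within this rate, of the probability of failure, where the
private random sources of the parties are independent. (No measurability of the simulation in the
coins is required; if the event is not measurable, its outer measure is taken.) -/
noncomputable def failureProbability (S : BlackBoxSimulation G T) (ρ : ℝ) : ℝ≥0∞ :=
  ⨆ (A : S.Adversary) (_ : S.WithinPerEdgeRate A ρ) (x : Input G T),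
    Measure.pi S.coinLaw {ω | S.Fails A x ω}

end BlackBoxSimulation

/-- A black-box compiler: it takes a universal protocol, given by a simple digraph `G` on finitely
many parties and a number `T` of rounds, to a black-box simulation of it. -/
abbrev BlackBoxCompiler : Type 1 :=
  (n : ℕ) → (G : Digraph (Fin n)) → IsSimple G → (T : ℕ) → BlackBoxSimulation G T

/-- For every digraph, the query complexity of the simulations is bounded by a polynomial
in `T`. -/
def BlackBoxCompiler.IsPolynomialQuery (C : BlackBoxCompiler) : Prop :=
  ∀ (n : ℕ) (G : Digraph (Fin n)) (hG : IsSimple G), ∃ Q : Polynomial ℕ, ∀ T : ℕ,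
    (C n G hG T).queryComplexity ≤ ((Q.eval T : ℕ) : ℕ∞)

end NoisyNetwork

/-! Take vertices `ν 0, …, ν (J + 1)`, with `J + 2 = R`, each reachable from its predecessor, and
give them ranks `0, …, J + 1`. Let random `k`-bit messages `m 0, …, m J` be relayed along this
chain: `ν j` injects `m j` only if her history shows `m (j - 1)`. In the noiseless protocol `ν (J +
1)` thus learns `m J`.

The adversary cuts the rounds into blocks of length `L + 1` and, in the block with index `j`, erases
for `L` rounds all that arrives at rank `j + 1`. Let the input `x j` have injections from ranks
below `j` only, so that it does not depend on `m j`. Inputs `x j` and `x (j + 1)` differ only at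
rank `j`, on histories that contain `m (j - 1)`. A silenced party could reach such a history only by
guessing `m (j - 1)` in a query, so by induction each block lets knowledge pass at most one step
down the chain (`stateAt_hybrid_eq`). As `J + 1` blocks cover the simulation, `ν (J + 1)` ends in
the same state on `x J` as on `x (J + 1)` and has to guess `m J` too.

For fixed coins, `q` queries and one output give at most `q + 1` guesses per message, so success has
probability at most `(J + 1) * (q + 1) / 2 ^ k` (`two_pow_le_failureProbability`). Here `k` grows
linearly in `T`, while `q` is polynomial. The blocks need only `L` about `rounds / (R - 1)`, which
`4 / R` exceeds. -/

namespace NoisyNetwork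

/-! ### Query transcripts -/

namespace QueryComp

variable {Q A R : Type}

/-- The list of queries that a computation makes when they are answered by `f`. -/
def queries (f : Q → A) : QueryComp Q A R → List Q
  | .pure _ => []
  | .query q k => q :: (k (f q)).queries f

theorem length_queries (f : Q → A) (c : QueryComp Q A R) :
    (c.queries f).length = (c.run f).2 := by
  induction c with
  | pure r => rfl
  | query q k ih => simp [queries, run, ih]

theorem run_congr {f g : Q → A} (c : QueryComp Q A R) (h : ∀ q ∈ c.queries f, f q = g q) :
    c.run f = c.run g := by
  induction c with
  | pure r => rfl
  | query q k ih =>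
    have hq : f q = g q := h q (by simp [queries])
    have := ih (f q) fun p hp => h p (by simp [queries, hp])
    simp only [run]
    rw [← hq, this]

end QueryComp

/-! ### The silencing adversary and the hybrid argument -/

namespace BlackBoxSimulation

variable {V : Type} [Fintype V] {G : Digraph V} {T : ℕ}

/-- The state of a party at the beginning of round `r`. -/
def stateAt (S : BlackBoxSimulation G T) (A : S.Adversary) (ω : ∀ v, S.Coins v)
    (x : Input G T) (r : ℕ) (v : V) : S.State v :=
  ((S.step A x)^[r] (S.start ω)).state v

/-- The outcome of the computation that a party performs in round `r`. -/
def sendAt (S : BlackBoxSimulation G T) (A : S.Adversary) (ω : ∀ v, S.Coins v)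
    (x : Input G T) (r : ℕ) (v : V) : (S.State v × (OutNbr S.net v → Bool)) × ℕ :=
  (S.send v (S.stateAt A ω x r v)).run (x v)

/-- The queries that a party makes in round `r`. -/
def queriesAt (S : BlackBoxSimulation G T) (A : S.Adversary) (ω : ∀ v, S.Coins v)
    (x : Input G T) (r : ℕ) (v : V) : List (Query G T v) :=
  (S.send v (S.stateAt A ω x r v)).queries (x v)

theorem length_queriesAt (S : BlackBoxSimulation G T) (A : S.Adversary) (ω : ∀ v, S.Coins v)
    (x : Input G T) (r : ℕ) (v : V) :
    (S.queriesAt A ω x r v).length = (S.sendAt A ω x r v).2 :=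
  QueryComp.length_queries _ _

theorem queries_iterate_step (S : BlackBoxSimulation G T) (A : S.Adversary)
    (ω : ∀ v, S.Coins v) (x : Input G T) (r : ℕ) :
    ((S.step A x)^[r] (S.start ω)).queries =
      ∑ i ∈ Finset.range r, ∑ v, (S.queriesAt A ω x i v).length := by
  induction r with
  | zero => rfl
  | succ r ih =>
    rw [Function.iterate_succ_apply', Finset.sum_range_succ, ← ih]
    simp only [length_queriesAt]
    rfl

theorem sum_length_queriesAt_le (S : BlackBoxSimulation G T) (A : S.Adversary)
    (ω : ∀ v, S.Coins v) (x : Input G T) {q : ℕ} (hq : S.queryComplexity ≤ (q : ℕ∞)) :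
    ∑ i ∈ Finset.range S.rounds, ∑ v, (S.queriesAt A ω x i v).length ≤ q := by
  have h : (S.totalQueries A x ω : ℕ∞) ≤ q := by
    refine le_trans ?_ hq
    exact le_iSup_of_le A (le_iSup_of_le x (le_iSup_of_le ω le_rfl))
  have h' : S.totalQueries A x ω ≤ q := by exact_mod_cast h
  rw [← queries_iterate_step]
  exact (Nat.le_add_right _ _).trans h'

theorem length_sent_iterate_step (S : BlackBoxSimulation G T) (A : S.Adversary)
    (ω : ∀ v, S.Coins v) (x : Input G T) (r : ℕ) :
    ((S.step A x)^[r] (S.start ω)).sent.length = r := by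
  induction r with
  | zero => rfl
  | succ r ih =>
    rw [Function.iterate_succ_apply']
    simp [step, ih]

/-- The adversary that lets only zeros arrive at party `v` in the rounds from `a v` on, before
round `a v + L`, and that otherwise does not interfere. -/
def silencer (S : BlackBoxSimulation G T) (a : V → ℕ) (L : ℕ) : S.Adversary
  | _, [] => fun _ => false
  | _, out :: past => fun e =>
      if a e.1.2 ≤ past.length ∧ past.length < a e.1.2 + L then false else out e

theorem stateAt_silencer_succ (S : BlackBoxSimulation G T) (a : V → ℕ) (L : ℕ)
    (ω : ∀ v, S.Coins v) (x : Input G T) (r : ℕ) (v : V) :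
    S.stateAt (S.silencer a L) ω x (r + 1) v =
      S.receive v (S.sendAt (S.silencer a L) ω x r v).1.1
        (fun u => if a v ≤ r ∧ r < a v + L then false
          else (S.sendAt (S.silencer a L) ω x r u.1).1.2 ⟨v, u.2⟩) := by
  have h := S.length_sent_iterate_step (S.silencer a L) ω x r
  unfold stateAt
  rw [Function.iterate_succ_apply']
  simp only [step, silencer, h]
  rfl

theorem flips_silencer_le (S : BlackBoxSimulation G T) (a : V → ℕ) (L : ℕ)
    (ω : ∀ v, S.Coins v) (x : Input G T) (r : ℕ) (e : Edge S.net) :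
    ((S.step (S.silencer a L) x)^[r] (S.start ω)).flips e ≤ min (r - a e.1.2) L := by
  induction r with
  | zero => simp [start]
  | succ r ih =>
    have h := S.length_sent_iterate_step (S.silencer a L) ω x r
    rw [Function.iterate_succ_apply']
    simp only [step, silencer, h]
    by_cases hw : a e.1.2 ≤ r ∧ r < a e.1.2 + L
    · split_ifs <;> omega
    · simp only [hw, if_false, if_true]
      omega

theorem withinPerEdgeRate_silencer (S : BlackBoxSimulation G T) (a : V → ℕ) {L : ℕ} {ρ : ℝ}
    (h : (L : ℝ) ≤ ρ * S.rounds) : S.WithinPerEdgeRate (S.silencer a L) ρ := by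
  intro x ω e
  refine le_trans ?_ h
  exact_mod_cast (S.flips_silencer_le a L ω x S.rounds e).trans (min_le_right _ _)

/-- Hybrid argument: inputs `x j` and `x (j + 1)` differ only for the parties of rank `j`, and only
on queries that satisfy `trig j`. If no such query is made by the parties of rank `j + 1` on
input `x j`, for `j < J`, then the executions on inputs `x J` and `x (J + 1)` agree up to
round `J * (L + 1)`. -/
theorem stateAt_hybrid_eq (S : BlackBoxSimulation G T) (L : ℕ) (ω : ∀ v, S.Coins v)
    (rk : V → ℕ) (x : ℕ → Input G T) (trig : ℕ → ∀ v, Query G T v → Prop)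
    (hne : ∀ j v, rk v ≠ j → x j v = x (j + 1) v)
    (htrig : ∀ j v q, rk v = j → ¬ trig j v q → x j v q = x (j + 1) v q)
    {A : S.Adversary} (hA : A = S.silencer (fun v => (rk v - 1) * (L + 1)) L) (J : ℕ)
    (hq : ∀ j < J, ∀ v, rk v = j + 1 → ∀ r < S.rounds, ∀ q ∈ S.queriesAt A ω (x j) r v,
      ¬ trig (j + 1) v q) :
    (∀ r ≤ S.rounds, r ≤ J * (L + 1) → ∀ v, S.stateAt A ω (x J) r v
      = S.stateAt A ω (x (J + 1)) r v) ∧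
    ∀ v, rk v = J + 1 → ∀ r ≤ S.rounds, r < (J + 1) * (L + 1) →
      S.stateAt A ω (x J) r v = S.stateAt A ω (x (J + 1)) r v := by
  subst hA
  set A := S.silencer (fun v => (rk v - 1) * (L + 1)) L with hA
  -- While rank `J + 1` is silenced, her state evolves by her own input alone, and that is the same
  -- in `x J` and `x (J + 1)`. Bits are sent before any arrive, so `L` silenced rounds protect `L +
  -- 1` rounds of sending.
  have second : ∀ J, (∀ r ≤ S.rounds, r ≤ J * (L + 1) → ∀ v, S.stateAt A ω (x J) r v
      = S.stateAt A ω (x (J + 1)) r v) →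
      ∀ v, rk v = J + 1 → ∀ r ≤ S.rounds, r < (J + 1) * (L + 1) →
      S.stateAt A ω (x J) r v = S.stateAt A ω (x (J + 1)) r v := by
    intro J h v hv r
    induction r with
    | zero => intro _ _; rfl
    | succ r ih =>
      intro hr hr'
      rcases le_or_gt (r + 1) (J * (L + 1)) with hle | hgt
      · exact h _ hr hle v
      · have hst := ih (by omega) (by omega)
        have hw : (rk v - 1) * (L + 1) ≤ r ∧ r < (rk v - 1) * (L + 1) + L := by
          rw [hv, Nat.add_sub_cancel]
          constructor
          · omega
          · rw [add_mul] at hr'; omega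
        rw [hA, stateAt_silencer_succ, stateAt_silencer_succ, ← hA]
        simp only [hw, and_self, if_true]
        unfold sendAt
        rw [hst, hne J v (by omega)]
  induction J with
  | zero =>
    have h0 : ∀ r ≤ S.rounds, r ≤ 0 * (L + 1) → ∀ v, S.stateAt A ω (x 0) r v
        = S.stateAt A ω (x (0 + 1)) r v := by
      intro r _ hr v
      obtain rfl : r = 0 := by omega
      rfl
    exact ⟨h0, second 0 h0⟩
  | succ J ih =>
    obtain ⟨-, ih⟩ := ih fun j hj => hq j (by omega)
    have h1 : ∀ r ≤ S.rounds, r ≤ (J + 1) * (L + 1) → ∀ v, S.stateAt A ω (x (J + 1)) r v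
        = S.stateAt A ω (x (J + 1 + 1)) r v := by
      intro r
      induction r with
      | zero => intro _ _ _; rfl
      | succ r ihr =>
        intro hr hr' v
        have hst := ihr (by omega) (by omega)
        have hsend : ∀ v, S.sendAt A ω (x (J + 1)) r v = S.sendAt A ω (x (J + 1 + 1)) r v := by
          intro v
          unfold sendAt
          rw [← hst v]
          by_cases hv : rk v = J + 1
          · apply QueryComp.run_congr
            intro q hqm
            -- Her state and input are those of the execution on `x J`, so `hq` excludes triggering
            -- queries on `x (J + 1)` as well.
            rw [← ih v hv r (by omega) (by omega), ← hne J v (by omega)] at hqm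
            exact htrig _ v q hv (hq J (by omega) v hv r (by omega) q hqm)
          · rw [hne _ v hv]
        rw [hA, stateAt_silencer_succ, stateAt_silencer_succ, ← hA]
        simp only [hsend]
    exact ⟨h1, second _ h1⟩

end BlackBoxSimulation

/-! ### Flooding -/

/-- The message of phase `j` that is decoded from received bits: bit `b` is set if any bit that
arrived in segment `j * k + b`, of `N` rounds, is set. -/
noncomputable def decode {ι : Type} {s : ℕ} (N k : ℕ) (h : Fin s → ι → Bool) (j : ℕ) :
    Fin k → Bool :=
  open Classical in
  fun b => decide (∃ (i : Fin s) (u : ι), (i : ℕ) / N = j * k + b ∧ h i u = true)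

/-- Every party transmits a one if she has received a one in the current segment; moreover a party
of rank `i < j` injects the message `m i` in phase `i`, provided that she has decoded `m (i - 1)`
in phase `i - 1`. -/
noncomputable def floodInput {V : Type} (G : Digraph V) (T : ℕ) (rk : V → ℕ) (N k : ℕ)
    (m : ℕ → Fin k → Bool) (j : ℕ) : Input G T :=
  open Classical in
  fun v q _ => decide
    ((rk v < j ∧ (rk v = 0 ∨ decode N k q.2 (rk v - 1) = m (rk v - 1)) ∧
        ∃ b : Fin k, (q.1 : ℕ) / N = rk v * k + b ∧ m (rk v) b = true) ∨
      ∃ (i : Fin q.1) (u : InNbr G v), (i : ℕ) / N = (q.1 : ℕ) / N ∧ q.2 i u = true)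

variable {V : Type} {G : Digraph V} {T : ℕ}

theorem floodInput_eq_true_iff {rk : V → ℕ} {N k : ℕ} {m : ℕ → Fin k → Bool} {j : ℕ} {v : V}
    {s : Fin T} {h : Fin s → InNbr G v → Bool} {w : OutNbr G v} :
    floodInput G T rk N k m j v ⟨s, h⟩ w = true ↔
      (rk v < j ∧ (rk v = 0 ∨ decode N k h (rk v - 1) = m (rk v - 1)) ∧
        ∃ b : Fin k, (s : ℕ) / N = rk v * k + b ∧ m (rk v) b = true) ∨
      ∃ (i : Fin s) (u : InNbr G v), (i : ℕ) / N = (s : ℕ) / N ∧ h i u = true := by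
  classical
  rw [floodInput, decide_eq_true_iff]

theorem floodInput_succ_of_ne {rk : V → ℕ} {N k : ℕ} {m : ℕ → Fin k → Bool} {j : ℕ} {v : V}
    (h : rk v ≠ j) : floodInput G T rk N k m j v = floodInput G T rk N k m (j + 1) v := by
  have : rk v < j + 1 ↔ rk v < j := by omega
  funext ⟨s, p⟩ w
  rw [Bool.eq_iff_iff, floodInput_eq_true_iff, floodInput_eq_true_iff, this]

/-- This is why injection is conditional: finding out whether rank `j` injects requires a history
that already encodes `m (j - 1)`. -/
theorem floodInput_succ_of_decode_ne {rk : V → ℕ} {N k : ℕ} {m : ℕ → Fin k → Bool} {j : ℕ}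
    {v : V} {q : Query G T v} (h : rk v = j) (hj : j ≠ 0)
    (hq : decode N k q.2 (j - 1) ≠ m (j - 1)) :
    floodInput G T rk N k m j v q = floodInput G T rk N k m (j + 1) v q := by
  obtain ⟨s, p⟩ := q
  funext w
  rw [Bool.eq_iff_iff, floodInput_eq_true_iff, floodInput_eq_true_iff]
  simp [h, hj, hq]

/-- In particular the input with index `j` is independent of `m j`, so what is done on it can only
guess `m j`. -/
theorem floodInput_congr {rk : V → ℕ} {N k : ℕ} {m m' : ℕ → Fin k → Bool} {j : ℕ}
    (h : ∀ i < j, m i = m' i) :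
    floodInput G T rk N k m j = floodInput G T rk N k m' j := by
  funext v ⟨s, p⟩ w
  rw [Bool.eq_iff_iff, floodInput_eq_true_iff, floodInput_eq_true_iff]
  by_cases hv : rk v < j
  · rw [h _ hv, h (rk v - 1) (by omega)]
  · simp [hv]

theorem received_apply (x : Input G T) (t : ℕ) (h : t ≤ T) (v : V) (i : Fin t)
    (u : InNbr G v) :
    received x t h v i u =
      x u.1 ⟨⟨i, i.2.trans_le h⟩, received x i (i.2.le.trans h) u.1⟩ ⟨v, u.2⟩ := by
  induction t with
  | zero => exact i.elim0
  | succ t ih =>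
    refine Fin.lastCases ?_ (fun i => ?_) i
    · simp only [received, Fin.snoc_last]
      rfl
    · simp only [received, Fin.snoc_castSucc]
      exact ih _ i

theorem mul_add_inj_of_lt {k i i' : ℕ} {b b' : Fin k} (h : i * k + b = i' * k + b') :
    i = i' ∧ b = b' := by
  have hb := b.2
  have hb' := b'.2
  have h1 : (i * k + b) / k = i := by
    rw [mul_comm, Nat.mul_add_div (by omega), Nat.div_eq_of_lt hb, add_zero]
  have h2 : (i' * k + b') / k = i' := by
    rw [mul_comm, Nat.mul_add_div (by omega), Nat.div_eq_of_lt hb', add_zero]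
  have h3 : i = i' := by rw [← h1, h, h2]
  subst h3
  exact ⟨rfl, Fin.ext (by omega)⟩

/-- A segment determines its phase and bit, so nobody injects in it; relaying is confined to the
segment, so no earlier one leaks in. -/
theorem floodInput_received_eq_false {rk : V → ℕ} {N k : ℕ} {m : ℕ → Fin k → Bool} {j i : ℕ}
    {b : Fin k} (hb : m i b = false) (t : ℕ) (ht : t < T) (hseg : t / N = i * k + b) (v : V)
    (w : OutNbr G v) :
    floodInput G T rk N k m j v ⟨⟨t, ht⟩, received (floodInput G T rk N k m j) t ht.le v⟩ w
      = false := by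
  induction t using Nat.strong_induction_on generalizing v with
  | _ t ih =>
    rw [← Bool.not_eq_true, floodInput_eq_true_iff]
    rintro (⟨-, -, b', hb', hm⟩ | ⟨s, u, hs, hr⟩)
    · obtain ⟨rfl, rfl⟩ := mul_add_inj_of_lt (hseg.symm.trans hb')
      simp [hb] at hm
    · rw [received_apply, ih s s.2 (s.2.trans ht) (hs.trans hseg)] at hr
      exact Bool.false_ne_true hr

/-- There is a walk with `d` edges from `a` to the given vertex. -/
def HasWalk (G : Digraph V) (a : V) : ℕ → V → Prop
  | 0, v => v = a
  | d + 1, v => ∃ u, HasWalk G a d u ∧ G.Adj u v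

theorem exists_hasWalk_of_transGen {a v : V} (h : Relation.TransGen G.Adj a v) :
    ∃ d, HasWalk G a (d + 1) v := by
  induction h with
  | single h => exact ⟨0, _, rfl, h⟩
  | tail _ h ih => exact ih.imp' (· + 1) fun d hd => ⟨_, hd, h⟩

/-- The source sends ones throughout the segment, and everyone relays; each edge of the walk costs
one round. -/
theorem floodInput_received_eq_true {rk : V → ℕ} {N k : ℕ} {m : ℕ → Fin k → Bool} {j i : ℕ}
    {b : Fin k} {a : V} (hi : rk a = i) (hj : i < j) (hb : m (i) b = true)
    (htrig : ∀ t (ht : t ≤ T), i * k * N ≤ t → i = 0 ∨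
      decode N k (received (floodInput G T rk N k m j) t ht a) (i - 1) = m (i - 1))
    (d o : ℕ) (hd : d ≤ o) (ho : o < N) (v : V) (hv : HasWalk G a d v)
    (ht : (i * k + b) * N + o < T) (w : OutNbr G v) :
    floodInput G T rk N k m j v
      ⟨⟨(i * k + b) * N + o, ht⟩, received (floodInput G T rk N k m j) _ ht.le v⟩ w
      = true := by
  have hdiv : ∀ o < N, ((i * k + b) * N + o) / N = i * k + b := by
    intro o ho
    rw [mul_comm, Nat.mul_add_div (by omega), Nat.div_eq_of_lt ho, add_zero]
  induction d generalizing o v with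
  | zero =>
    obtain rfl : v = a := hv
    rw [floodInput_eq_true_iff]
    rw [hi]
    refine Or.inl ⟨hj, htrig _ _ ?_, b, hdiv o ho, hb⟩
    nlinarith
  | succ d ih =>
    obtain ⟨u, hu, huv⟩ := hv
    rw [floodInput_eq_true_iff]
    refine Or.inr ⟨⟨(i * k + b) * N + (o - 1), ?_⟩, ⟨u, huv⟩, ?_, ?_⟩
    · change _ < (i * k + b) * N + o
      omega
    · exact (hdiv _ (by omega)).trans (hdiv o ho).symm
    · rw [received_apply]
      exact ih (o - 1) (by omega) (by omega) u hu (by omega) _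

theorem decode_received_floodInput {rk : V → ℕ} {N k : ℕ} {m : ℕ → Fin k → Bool} {J : ℕ}
    {ν : ℕ → V} (hν : ∀ i ≤ J, rk (ν i) = i)
    (hwalk : ∀ i ≤ J, ∃ d < N, HasWalk G (ν i) (d + 1) (ν (i + 1))) (i : ℕ) (hi : i ≤ J)
    (s : ℕ) (hs : s ≤ T) (his : (i + 1) * k * N ≤ s) :
    decode N k (received (floodInput G T rk N k m (J + 1)) s hs (ν (i + 1))) i = m i := by
  induction i using Nat.strong_induction_on generalizing s with
  | _ i ih =>
    have hrk := hν i hi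
    funext b
    classical
    rw [Bool.eq_iff_iff, decode, decide_eq_true_iff]
    constructor
    · rintro ⟨t, u, ht, hr⟩
      by_contra hb
      rw [received_apply, floodInput_received_eq_false (Bool.not_eq_true _ ▸ hb) t _ ht] at hr
      exact Bool.false_ne_true hr
    · intro hb
      obtain ⟨d, hd, u, hu, huv⟩ := hwalk i hi
      -- The one arrives at offset `d < N` of segment `i * k + b`, and that segment lies before the
      -- end of phase `i`.
      have hlt : (i * k + b) * N + d < s := by
        have h1 : i * k + b + 1 ≤ (i + 1) * k := by
          have := b.2
          rw [add_mul]
          omega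
        have h2 := Nat.mul_le_mul_right N h1
        rw [add_mul _ 1] at h2
        omega
      refine ⟨⟨(i * k + b) * N + d, hlt⟩, ⟨u, huv⟩, ?_, ?_⟩
      · change ((i * k + b) * N + d) / N = _
        rw [mul_comm, Nat.mul_add_div (by omega), Nat.div_eq_of_lt hd, add_zero]
      · rw [received_apply]
        refine floodInput_received_eq_true hrk (by omega) hb (fun t ht hle => ?_)
          d d le_rfl hd u hu _ _
        rcases i with _ | i
        · exact Or.inl rfl
        · exact Or.inr (ih i (by omega) (by omega) t ht hle)

/-! ### Counting -/

theorem card_filter_mem_mul_card_le {ι K : Type*} [Fintype ι] [DecidableEq ι] [Fintype K]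
    [DecidableEq K] (i : ι) (D : (ι → K) → Finset K) {c : ℕ}
    (hD : ∀ m y, D (Function.update m i y) = D m) (hc : ∀ m, (D m).card ≤ c) :
    (Finset.univ.filter fun m => m i ∈ D m).card * Fintype.card K
      ≤ c * Fintype.card (ι → K) := by
  have h : ((Finset.univ.filter fun m => m i ∈ D m) ×ˢ (Finset.univ : Finset K)).card
      ≤ ((Finset.univ : Finset (ι → K)).sigma D).card := by
    refine Finset.card_le_card_of_injOn
      -- Swapping coordinate `i` with `y` is injective, and the removed value lies in the set `D`,
      -- which ignores coordinate `i`.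
      (fun p => ⟨Function.update p.1 i p.2, p.1 i⟩) ?_ ?_
    · rintro ⟨m, y⟩ hm
      simpa [hD] using hm
    · rintro ⟨m, y⟩ - ⟨m', y'⟩ - he
      simp only [Sigma.mk.injEq, heq_eq_eq] at he
      obtain ⟨h1, h2⟩ := he
      have hm : m = m' := by
        funext l
        by_cases hl : l = i
        · rw [hl, h2]
        · simpa [hl] using congrFun h1 l
      have hy : y = y' := by simpa using congrFun h1 i
      rw [hm, hy]
  rw [Finset.card_product, Finset.card_univ, Finset.card_sigma] at h
  refine h.trans ((Finset.sum_le_card_nsmul _ _ c fun m _ => hc m).trans ?_)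
  rw [Finset.card_univ, smul_eq_mul, mul_comm]

/-- If at every point at most the fraction `c / K` of the sets `F m` is missed, and all the sets
have outer measure at most `p`, then `1 ≤ p + c / K`. -/
theorem natCast_le_mul_add_of_card_le {Ω M : Type*} [MeasurableSpace Ω] [Fintype M] [Nonempty M]
    (μ : Measure Ω) [IsProbabilityMeasure μ] (F : M → Set Ω) {p : ℝ≥0∞} (hF : ∀ m, μ (F m) ≤ p)
    {K c : ℕ} (h : ∀ ω, Nat.card {m // ω ∉ F m} * K ≤ c * Fintype.card M) :
    (K : ℝ≥0∞) ≤ K * p + c := by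
  classical
  -- Failure events may be non-measurable; their measurable hulls have the same measure and can be
  -- integrated.
  have key : ∀ ω, ((Fintype.card M * K : ℕ) : ℝ≥0∞) ≤
      (∑ m, (toMeasurable μ (F m)).indicator (fun _ => (K : ℝ≥0∞)) ω)
        + ((c * Fintype.card M : ℕ) : ℝ≥0∞) := by
    intro ω
    have hsum : (((Finset.univ.filter fun m => ω ∈ F m).card * K : ℕ) : ℝ≥0∞) ≤
        ∑ m, (toMeasurable μ (F m)).indicator (fun _ => (K : ℝ≥0∞)) ω := by
      rw [Nat.cast_mul, ← nsmul_eq_mul, ← Finset.sum_const]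
      calc _ = ∑ m ∈ Finset.univ.filter (fun m => ω ∈ F m),
              (toMeasurable μ (F m)).indicator (fun _ => (K : ℝ≥0∞)) ω := by
            refine Finset.sum_congr rfl fun m hm => ?_
            rw [Set.indicator_of_mem]
            exact subset_toMeasurable _ _ (Finset.mem_filter.1 hm).2
        _ ≤ _ := Finset.sum_le_sum_of_subset (Finset.filter_subset _ _)
    have hcard := Finset.card_filter_add_card_filter_not (s := (Finset.univ : Finset M))
      (fun m => ω ∈ F m)
    have hω := h ω
    rw [Nat.card_eq_fintype_card, Fintype.card_subtype] at hω
    rw [Finset.card_univ] at hcard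
    refine le_trans ?_ (add_le_add_left hsum _)
    rw [← Nat.cast_add, Nat.cast_le]
    calc _ = (Finset.univ.filter fun m => ω ∈ F m).card * K +
          (Finset.univ.filter fun m => ω ∉ F m).card * K := by rw [← add_mul, hcard]
      _ ≤ _ := by omega
  have hint := lintegral_mono (μ := μ) key
  rw [lintegral_add_right _ measurable_const, lintegral_finsetSum _ fun m _ =>
    measurable_const.indicator (measurableSet_toMeasurable _ _)] at hint
  simp only [lintegral_const, measure_univ, mul_one,
    lintegral_indicator_const (measurableSet_toMeasurable _ _), measure_toMeasurable] at hint
  have hM : (Fintype.card M : ℝ≥0∞) ≠ 0 := by simp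
  have hM' : (Fintype.card M : ℝ≥0∞) ≠ ∞ := ENNReal.natCast_ne_top _
  have hp : ∑ m, (K : ℝ≥0∞) * μ (F m) ≤ Fintype.card M * (K * p) := by
    refine (Finset.sum_le_card_nsmul _ _ (K * p) fun m _ => mul_le_mul_right (hF m) _).trans ?_
    rw [nsmul_eq_mul, Finset.card_univ]
  refine (ENNReal.mul_le_mul_iff_right hM hM').1 ?_
  calc (Fintype.card M : ℝ≥0∞) * K ≤ Fintype.card M * (K * p) + (c * Fintype.card M : ℕ) := by
        exact_mod_cast hint.trans (add_le_add_left hp _)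
    _ = _ := by push_cast; ring

/-! ### Guessing the messages, and the bound on the failure probability -/

namespace BlackBoxSimulation

variable {V : Type} [Fintype V] {G : Digraph V} {T : ℕ}

/-- The messages of phase `j` that are decoded from the queries made, on input `x`, in all the
rounds, or from the final output of party `u`. -/
noncomputable def guesses (S : BlackBoxSimulation G T) (A : S.Adversary) (ω : ∀ v, S.Coins v)
    (x : Input G T) (u : V) (N k j : ℕ) : Finset (Fin k → Bool) :=
  ((Finset.range S.rounds).biUnion fun r => Finset.univ.biUnion fun v =>
      ((S.queriesAt A ω x r v).map fun q => decode N k q.2 j).toFinset) ∪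
    {decode N k (S.finalOutput A x ω u).1 j}

theorem card_guesses_le (S : BlackBoxSimulation G T) (A : S.Adversary) (ω : ∀ v, S.Coins v)
    (x : Input G T) (u : V) (N k j : ℕ) {q : ℕ} (hq : S.queryComplexity ≤ (q : ℕ∞)) :
    (S.guesses A ω x u N k j).card ≤ q + 1 := by
  refine (Finset.card_union_le _ _).trans (add_le_add ?_ (Finset.card_singleton _).le)
  refine le_trans ?_ (S.sum_length_queriesAt_le A ω x hq)
  refine Finset.card_biUnion_le.trans (Finset.sum_le_sum fun r _ => ?_)
  refine Finset.card_biUnion_le.trans (Finset.sum_le_sum fun v _ => ?_)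
  exact (List.toFinset_card_le _).trans (List.length_map _).le

/-- Unguessed messages trigger nothing, so the last party's output on `x (J + 1)` is her output on
`x J`. A correct output would decode to `m J`, which would then be among the guesses. -/
theorem fails_of_forall_notMem_guesses (S : BlackBoxSimulation G T) (ω : ∀ v, S.Coins v)
    {rk : V → ℕ} {N k J L : ℕ} (m : ℕ → Fin k → Bool) {ν : ℕ → V}
    (hν : ∀ i ≤ J + 1, rk (ν i) = i)
    (hwalk : ∀ i ≤ J, ∃ d < N, HasWalk G (ν i) (d + 1) (ν (i + 1)))
    (hT : (J + 1) * k * N ≤ T) (hL : S.rounds < (J + 1) * (L + 1))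
    {A : S.Adversary} (hA : A = S.silencer (fun v => (rk v - 1) * (L + 1)) L)
    (hm : ∀ j ≤ J, m j ∉ S.guesses A ω (floodInput G T rk N k m j) (ν (J + 1)) N k j) :
    S.Fails A (floodInput G T rk N k m (J + 1)) ω := by
  have hy := (S.stateAt_hybrid_eq L ω rk (floodInput G T rk N k m)
    -- Rank 0 injects unconditionally, so all her queries count as triggering.
    (fun j _ q => j = 0 ∨ decode N k q.2 (j - 1) = m (j - 1))
    (fun j v h => floodInput_succ_of_ne h)
    (fun j v q h hq => by
      rw [not_or] at hq
      exact floodInput_succ_of_decode_ne h hq.1 hq.2)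
    hA J (fun j hj v _ r hr q hq => by
      rintro (h | h)
      · omega
      · refine hm j hj.le (Finset.mem_union_left _ ?_)
        simp only [Finset.mem_biUnion, Finset.mem_range, Finset.mem_univ, true_and,
          List.mem_toFinset, List.mem_map]
        exact ⟨r, hr, v, q, hq, h⟩)).2 (ν (J + 1)) (hν _ le_rfl) S.rounds le_rfl hL
  refine ⟨ν (J + 1), fun he => hm J le_rfl (Finset.mem_union_right _ ?_)⟩
  have hout : S.finalOutput A (floodInput G T rk N k m J) ω (ν (J + 1)) =
      S.finalOutput A (floodInput G T rk N k m (J + 1)) ω (ν (J + 1)) := by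
    change (S.output _ (S.stateAt A ω _ S.rounds _)).run _ =
      (S.output _ (S.stateAt A ω _ S.rounds _)).run _
    rw [hy, floodInput_succ_of_ne (by rw [hν _ le_rfl]; omega)]
  rw [Finset.mem_singleton, hout, he]
  exact (decode_received_floodInput (fun i hi => hν i (by omega)) hwalk J le_rfl T le_rfl hT).symm

theorem two_pow_le_failureProbability (S : BlackBoxSimulation G T)
    {rk : V → ℕ} {N k J L q : ℕ} {ρ : ℝ} {ν : ℕ → V}
    (hν : ∀ i ≤ J + 1, rk (ν i) = i)
    (hwalk : ∀ i ≤ J, ∃ d < N, HasWalk G (ν i) (d + 1) (ν (i + 1)))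
    (hT : (J + 1) * k * N ≤ T) (hL : S.rounds < (J + 1) * (L + 1))
    (hρ : (L : ℝ) ≤ ρ * S.rounds) (hq : S.queryComplexity ≤ (q : ℕ∞)) :
    ((2 ^ k : ℕ) : ℝ≥0∞) ≤ ((2 ^ k : ℕ) : ℝ≥0∞) * S.failureProbability ρ
      + (((J + 1) * (q + 1) : ℕ) : ℝ≥0∞) := by
  classical
  set A : S.Adversary := S.silencer (fun v => (rk v - 1) * (L + 1)) L with hA
  let ext : (Fin (J + 1) → Fin k → Bool) → ℕ → Fin k → Bool :=
    fun m j => if h : j < J + 1 then m ⟨j, h⟩ else fun _ => false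
  refine natCast_le_mul_add_of_card_le (Measure.pi S.coinLaw)
    (fun m => {ω | S.Fails A (floodInput G T rk N k (ext m) (J + 1)) ω}) (fun m => ?_)
    (fun ω => ?_)
  · exact le_iSup_of_le A (le_iSup_of_le (S.withinPerEdgeRate_silencer _ hρ)
      (le_iSup_of_le _ le_rfl))
  · let D : Fin (J + 1) → (Fin (J + 1) → Fin k → Bool) → Finset (Fin k → Bool) := fun j m =>
      S.guesses A ω (floodInput G T rk N k (ext m) j) (ν (J + 1)) N k j
    have hD : ∀ j, (Finset.univ.filter fun m => m j ∈ D j m).card * 2 ^ k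
        ≤ (q + 1) * Fintype.card (Fin (J + 1) → Fin k → Bool) := by
      intro j
      have := card_filter_mem_mul_card_le j (D j) (c := q + 1) (fun m y => ?_)
        (fun m => S.card_guesses_le A ω _ _ _ _ _ hq)
      · simpa using this
      · simp only [D]
        -- The guesses for message `j` depend only on the earlier messages, so changing `m j` leaves
        -- them alone.
        rw [floodInput_congr fun i hi => ?_]
        have hij : (⟨i, hi.trans j.2⟩ : Fin (J + 1)) ≠ j := fun h => by
          rw [← h] at hi
          exact lt_irrefl _ hi
        simp only [ext, hi.trans j.2, dif_pos, Function.update_of_ne hij]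
    rw [Nat.card_eq_fintype_card, Fintype.card_subtype]
    have hsub : (Finset.univ.filter fun m => ω ∉
        {ω | S.Fails A (floodInput G T rk N k (ext m) (J + 1)) ω}) ⊆
        Finset.univ.biUnion fun j => Finset.univ.filter fun m => m j ∈ D j m := by
      intro m hm
      by_contra hcon
      refine (Finset.mem_filter.1 hm).2
        (S.fails_of_forall_notMem_guesses ω (ext m) hν hwalk hT hL hA fun j hj hmem => hcon ?_)
      refine Finset.mem_biUnion.2 ⟨⟨j, by omega⟩, Finset.mem_univ _,
        Finset.mem_filter.2 ⟨Finset.mem_univ _, ?_⟩⟩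
      have he : ext m j = m ⟨j, by omega⟩ := dif_pos (by omega)
      rwa [he] at hmem
    calc _ ≤ (∑ j, (Finset.univ.filter fun m => m j ∈ D j m).card) * 2 ^ k :=
          Nat.mul_le_mul_right _ ((Finset.card_le_card hsub).trans Finset.card_biUnion_le)
      _ = ∑ j, (Finset.univ.filter fun m => m j ∈ D j m).card * 2 ^ k := Finset.sum_mul _ _ _
      _ ≤ ∑ _j : Fin (J + 1), (q + 1) * Fintype.card (Fin (J + 1) → Fin k → Bool) :=
          Finset.sum_le_sum fun j _ => hD j
      _ = _ := by
          rw [Finset.sum_const, Finset.card_univ, Fintype.card_fin, smul_eq_mul, mul_assoc]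

theorem failureProbability_le_one (S : BlackBoxSimulation G T) (ρ : ℝ) :
    S.failureProbability ρ ≤ 1 :=
  iSup_le fun _ => iSup_le fun _ => iSup_le fun _ => prob_le_one

theorem failureProbability_mono (S : BlackBoxSimulation G T) {ρ ρ' : ℝ} (h : ρ ≤ ρ') :
    S.failureProbability ρ ≤ S.failureProbability ρ' :=
  iSup_mono fun _ => iSup_le fun hA => le_iSup_of_le
    (fun x ω e => (hA x ω e).trans (mul_le_mul_of_nonneg_right h (Nat.cast_nonneg _))) le_rfl

end BlackBoxSimulation

/-! ### Chains -/

theorem exists_chainLength_walk {V : Type} [Fintype V] [Nonempty V] [DecidableEq V]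
    (G : Digraph V) :
    ∃ W : List V, W.IsChain G.Adj ∧ W.toFinset.card = chainLength G := by
  obtain ⟨W, -, h⟩ : chainLength G ∈
      {k : ℕ | ∃ W : List V, W ≠ [] ∧ W.IsChain G.Adj ∧ W.toFinset.card = k} := by
    refine Nat.sSup_mem ⟨1, [Classical.arbitrary V], by simp⟩ ⟨Fintype.card V, ?_⟩
    rintro _ ⟨W, -, -, rfl⟩
    exact Finset.card_le_univ _
  exact ⟨W, h⟩

theorem two_le_chainLength {V : Type} [Fintype V] [Nonempty V] [DecidableEq V] {G : Digraph V}
    (hG : IsSimple G) (h : NoIsolatedVertices G) : 2 ≤ chainLength G := by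
  obtain ⟨a, b, hab⟩ : ∃ a b, G.Adj a b := by
    obtain ⟨u, hu | hu⟩ := h (Classical.arbitrary V)
    · exact ⟨_, _, hu⟩
    · exact ⟨_, _, hu⟩
  have hne : a ≠ b := by
    rintro rfl
    exact hG _ hab
  refine le_csSup ⟨Fintype.card V, ?_⟩ ⟨[a, b], by simp, by simpa using hab, ?_⟩
  · rintro _ ⟨W, -, -, rfl⟩
    exact Finset.card_le_univ _
  · simp [Finset.card_pair hne]

/-- Ranks of the vertices, in the order of a walk that attains the chain-length. -/
theorem exists_rank_hasWalk {V : Type} [Fintype V] [Nonempty V] [DecidableEq V]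
    (G : Digraph V) {J : ℕ} (hJ : chainLength G = J + 2) :
    ∃ (rk : V → ℕ) (ν : ℕ → V) (N : ℕ), 0 < N ∧ (∀ i ≤ J + 1, rk (ν i) = i) ∧
      ∀ i ≤ J, ∃ d < N, HasWalk G (ν i) (d + 1) (ν (i + 1)) := by
  obtain ⟨W, hW, hcard⟩ := exists_chainLength_walk G
  have hlen : W.dedup.length = J + 2 := by rw [← hJ, ← hcard, List.card_toFinset]
  -- Deduplication can break adjacency, but reachability by a nonempty walk is transitive and passes
  -- to sublists.
  have hpair : W.dedup.Pairwise (Relation.TransGen G.Adj) :=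
    (List.isChain_iff_pairwise.1 (hW.imp fun _ _ => Relation.TransGen.single)).sublist
      (List.dedup_sublist W)
  let ν : ℕ → V := fun i => W.dedup.getD i (Classical.arbitrary V)
  have hν : ∀ i (hi : i < W.dedup.length), ν i = W.dedup[i] := fun i hi =>
    List.getD_eq_getElem _ _ hi
  have hwalk : ∀ i, ∃ d, i ≤ J → HasWalk G (ν i) (d + 1) (ν (i + 1)) := by
    intro i
    by_cases hi : i ≤ J
    · have := List.pairwise_iff_getElem.1 hpair i (i + 1) (by omega) (by omega) (by omega)
      rw [← hν, ← hν] at this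
      exact (exists_hasWalk_of_transGen this).imp fun d hd _ => hd
    · exact ⟨0, fun h => absurd h hi⟩
  choose d hd using hwalk
  refine ⟨fun v => W.dedup.idxOf v, ν, (Finset.range (J + 1)).sup d + 1, by omega,
    fun i hi => ?_, fun i hi => ⟨d i, ?_, hd i hi⟩⟩
  · change W.dedup.idxOf (ν i) = i
    rw [hν i (by omega)]
    exact (List.nodup_dedup W).idxOf_getElem i _
  · exact Nat.lt_succ_of_le (Finset.le_sup (Finset.mem_range.2 (by omega)))

/-! ### Asymptotics -/

theorem tendsto_eval_div_two_pow (P : Polynomial ℕ) :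
    Tendsto (fun k : ℕ => ((P.eval k : ℕ) : ℝ) / 2 ^ k) atTop (𝓝 0) := by
  induction P using Polynomial.induction_on' with
  | add p q hp hq => simpa [add_div] using hp.add hq
  | monomial n a =>
    have := (tendsto_pow_const_div_const_pow_of_one_lt n (one_lt_two (α := ℝ))).const_mul (a : ℝ)
    simpa [mul_div_assoc] using this

theorem eval_mono_nat (P : Polynomial ℕ) {a b : ℕ} (h : a ≤ b) : P.eval a ≤ P.eval b := by
  rw [Polynomial.eval_eq_sum, Polynomial.eval_eq_sum]
  exact Finset.sum_le_sum fun i _ => Nat.mul_le_mul_left _ (Nat.pow_le_pow_left h i)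

theorem tendsto_eval_div_two_pow_div (P : Polynomial ℕ) {c : ℕ} (hc : 0 < c) :
    Tendsto (fun T : ℕ => ((P.eval T : ℕ) : ℝ≥0∞) / ((2 ^ (T / c) : ℕ) : ℝ≥0∞)) atTop (𝓝 0) := by
  have h1 := (tendsto_eval_div_two_pow (P.comp (Polynomial.C c * (Polynomial.X + 1)))).comp
    (Nat.tendsto_div_const_atTop hc.ne')
  -- With `k = T / c` one has `T ≤ c * (k + 1)`, so the numerator is at most a polynomial in `k`.
  have h2 : Tendsto (fun T : ℕ => ((P.eval T : ℕ) : ℝ) / 2 ^ (T / c)) atTop (𝓝 0) := by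
    refine squeeze_zero (fun T => by positivity) (fun T => ?_) h1
    simp only [Function.comp]
    gcongr
    simp only [Polynomial.eval_comp, Polynomial.eval_mul, Polynomial.eval_C, Polynomial.eval_add,
      Polynomial.eval_X, Polynomial.eval_one]
    refine eval_mono_nat P (Nat.lt_mul_div_succ T hc).le
  have h3 := ENNReal.tendsto_ofReal h2
  rw [ENNReal.ofReal_zero] at h3
  refine h3.congr fun T => ?_
  rw [ENNReal.ofReal_div_of_pos (by positivity), ENNReal.ofReal_natCast]
  congr 1
  rw [← ENNReal.ofReal_natCast]
  push_cast
  rfl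

theorem tendsto_failureProbability {V : Type} [Fintype V] [Nonempty V] [DecidableEq V]
    {G : Digraph V} (hG : IsSimple G) (hiso : NoIsolatedVertices G)
    (S : ∀ T, BlackBoxSimulation G T) {Q : Polynomial ℕ}
    (hQ : ∀ T, (S T).queryComplexity ≤ ((Q.eval T : ℕ) : ℕ∞)) :
    Tendsto (fun T => (S T).failureProbability (4 / (chainLength G : ℝ))) atTop (𝓝 1) := by
  obtain ⟨J, hJ⟩ := Nat.exists_eq_add_of_le' (two_le_chainLength hG hiso)
  obtain ⟨rk, ν, N, hN, hν, hwalk⟩ := exists_rank_hasWalk G hJ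
  have hc : 0 < (J + 1) * N := by positivity
  set P : Polynomial ℕ := Polynomial.C (J + 1) * (Q + 1) with hP
  have hlim := tendsto_eval_div_two_pow_div P hc
  have hlow : ∀ T, 1 - ((P.eval T : ℕ) : ℝ≥0∞) / ((2 ^ (T / ((J + 1) * N)) : ℕ) : ℝ≥0∞) ≤
      (S T).failureProbability (4 / (chainLength G : ℝ)) := by
    intro T
    set k := T / ((J + 1) * N) with hk
    have hR : (0 : ℝ) ≤ 4 / (chainLength G : ℝ) * (S T).rounds := by positivity
    have hmain := (S T).two_pow_le_failureProbability (k := k)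
      (L := ⌊4 / (chainLength G : ℝ) * (S T).rounds⌋₊) hν hwalk
      (by
        calc (J + 1) * k * N = (J + 1) * N * k := by ring
          _ ≤ T := Nat.mul_div_le _ _)
      (by
        have h1 := Nat.lt_floor_add_one (4 / (chainLength G : ℝ) * (S T).rounds)
        rw [hJ] at h1 ⊢
        -- The blocks cover all rounds because `(J + 1) * 4 / (J + 2) ≥ 1`, with room to spare.
        have h2 : (((S T).rounds : ℕ) : ℝ) < (J + 1) *
            ((⌊4 / ((J + 2 : ℕ) : ℝ) * (S T).rounds⌋₊ : ℝ) + 1) := by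
          refine lt_of_le_of_lt ?_ (mul_lt_mul_of_pos_left h1 (by positivity))
          have h3 : (0 : ℝ) < ((J + 2 : ℕ) : ℝ) := by positivity
          rw [← mul_assoc]
          refine le_mul_of_one_le_left (by positivity) ?_
          rw [mul_div_assoc', le_div_iff₀ h3]
          push_cast
          nlinarith [(Nat.cast_nonneg J : (0 : ℝ) ≤ J)]
        exact_mod_cast h2)
      (Nat.floor_le hR) (hQ T)
    have hPe : P.eval T = (J + 1) * (Q.eval T + 1) := by simp [hP]
    rw [← hPe] at hmain
    have h0 : ((2 ^ k : ℕ) : ℝ≥0∞) ≠ 0 := by simp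
    have ht : ((2 ^ k : ℕ) : ℝ≥0∞) ≠ ∞ := ENNReal.natCast_ne_top _
    rw [tsub_le_iff_right]
    refine (ENNReal.mul_le_mul_iff_right h0 ht).1 ?_
    rw [mul_one, mul_add, ENNReal.mul_div_cancel h0 ht]
    exact hmain
  refine tendsto_of_tendsto_of_tendsto_of_le_of_le ?_ tendsto_const_nhds hlow
    fun T => (S T).failureProbability_le_one _
  have := ENNReal.Tendsto.sub (tendsto_const_nhds (x := (1 : ℝ≥0∞)) (f := atTop)) hlim
    (Or.inl ENNReal.one_ne_top)
  simpa using this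

end NoisyNetwork

theorem mainTheorem7 (C : NoisyNetwork.BlackBoxCompiler) (hC : C.IsPolynomialQuery)
    (n : ℕ) (hn : 0 < n) (G : Digraph (Fin n)) (hG : NoisyNetwork.IsSimple G)
    (hiso : NoisyNetwork.NoIsolatedVertices G) :
    Filter.Tendsto
        (fun T : ℕ => (C n G hG T).failureProbability (4 / (NoisyNetwork.chainLength G : ℝ)))
        Filter.atTop (nhds 1) ∧
      ∀ ρ : ℝ,
        (∃ c : ENNReal, c < 1 ∧
          ∃ᶠ T : ℕ in Filter.atTop, (C n G hG T).failureProbability ρ ≤ c) →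
        ρ < 4 / (NoisyNetwork.chainLength G : ℝ) := by
  obtain ⟨Q, hQ⟩ := hC n G hG
  have : Nonempty (Fin n) := ⟨⟨0, hn⟩⟩
  have hlim := NoisyNetwork.tendsto_failureProbability hG hiso (fun T => C n G hG T) hQ
  refine ⟨hlim, ?_⟩
  rintro ρ ⟨c, hc, hfreq⟩
  by_contra! hρ
  refine hfreq ((hlim.eventually (lt_mem_nhds hc)).mono fun T hT => not_le.2 ?_)
  exact hT.trans_le ((C n G hG T).failureProbability_mono hρ)
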